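/- Let $F$ be a field of characteristic different from $2$, let $A$ be a prime Lie algebra over $F$, or a prime Lie superalgebra over $F$ regarded as an algebra with multiplication $ab$ (its grading being forgotten below), of arbitrary dimension, and let $\{\cdot,\cdot\}\colon A\times A\to A$ be an arbitrary bilinear operation. Here a (super)algebra is called prime if it has no two nonzero (graded, in the case of a superalgebra) left ideals $I,J$, possibly equal, with $IJ=JI=0$. The (generalized) Kantor double of $A$ is the superalgebra $K(A)=A\oplus Ax$ with even part $A$, odd part $Ax$ (a copy of the vector space $A$) and multiplication $$a\cdot b=ab,\qquad a\cdot(bx)=(ax)\cdot b=(ab)x,\qquad (ax)\cdot(bx)=\{a,b\}\qquad(a,b\in A).$$ For $\delta\in F$, a $\delta$-derivation of a space with a bilinear operation $*$ is a linear map $\varphi$ with $\varphi(u*v)=\delta(\varphi(u)*v+u*\varphi(v))$ for all $u,v$. Let $\Delta_\delta(A)$ and $\Delta_\delta(A,\{\,,\})$ be the sets of $\delta$-derivations of $A$ with respect to the multiplication $ab$ and the operation $\{\,,\}$ respectively. A $\delta$-derivation $\varphi$ of $K(A)$ is even if $\varphi(A)\subseteq A$ and $\varphi(Ax)\subseteq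 Ax$; it is nontrivial if $\varphi\neq0$, $\delta\neq0,1$, and $\varphi$ is not in the centroid of $K(A)$, i.e. it is not true that $\varphi(uv)=\varphi(u)v=u\varphi(v)$ for all $u,v\in K(A)$. Then: 1. if $K(A)$ has a nontrivial even $\delta$-derivation, then $\delta=\tfrac12$ or $\delta=-1$; 2. for $\delta=\tfrac12$ and for $\delta=-1$, the even $\delta$-derivations of $K(A)$ (trivial or not) are exactly the linear maps $\varphi$ of the form $\varphi(a+bx)=\psi(a)+\psi(b)x$ with $\psi\in\Delta_\delta(A)\cap\Delta_\delta(A,\{\,,\})$. -/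

import Mathlib

/-! An algebra over `F` (not assumed associative, commutative or unital) is an `F`-module `V`
with a bilinear multiplication `m : V →ₗ[F] V →ₗ[F] V`. -/

section Algebras

variable {F V : Type*} [Field F] [AddCommGroup V] [Module F V]

/-- The set of `δ`-derivations of the algebra `(V, m)`: linear maps `φ` with
`φ(xy) = δ (φ(x) y + x φ(y))`. -/
def deltaDerivations (m : V →ₗ[F] V →ₗ[F] V) (δ : F) : Set (V →ₗ[F] V) :=
  {φ | ∀ x y, φ (m x y) = δ • (m (φ x) y + m x (φ y))}

/-- The centroid of the algebra `(V, m)`: linear maps `χ` with `χ(xy) = χ(x) y = x χ(y)`. -/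
def centroidMaps (m : V →ₗ[F] V →ₗ[F] V) : Set (V →ₗ[F] V) :=
  {χ | ∀ x y, χ (m x y) = m (χ x) y ∧ χ (m x y) = m x (χ y)}

/-- A `δ`-derivation is nontrivial if it is nonzero, `δ ≠ 0, 1`, and it is not in the centroid. -/
def IsNontrivialDeltaDerivation (m : V →ₗ[F] V →ₗ[F] V) (δ : F) (φ : V →ₗ[F] V) : Prop :=
  φ ∈ deltaDerivations m δ ∧ φ ≠ 0 ∧ δ ≠ 0 ∧ δ ≠ 1 ∧ φ ∉ centroidMaps m

/-- `I` is a left ideal of the algebra `(V, m)`. -/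
def IsLeftIdeal (m : V →ₗ[F] V →ₗ[F] V) (I : Submodule F V) : Prop :=
  ∀ a, ∀ x ∈ I, m a x ∈ I

/-- `I` and `J` annihilate each other: `IJ = JI = 0`. -/
def MutuallyAnnihilate (m : V →ₗ[F] V →ₗ[F] V) (I J : Submodule F V) : Prop :=
  ∀ x ∈ I, ∀ y ∈ J, m x y = 0 ∧ m y x = 0

/-- A prime algebra: no two nonzero left ideals (possibly equal) annihilate each other. -/
def IsPrimeAlgebra (m : V →ₗ[F] V →ₗ[F] V) : Prop :=
  ∀ I J : Submodule F V, IsLeftIdeal m I → IsLeftIdeal m J →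
    MutuallyAnnihilate m I J → I = ⊥ ∨ J = ⊥

/-- The subspace `I` is homogeneous for the `ℤ/2`-grading `𝒜`. -/
def IsGradedSubspace (𝒜 : ZMod 2 → Submodule F V) (I : Submodule F V) : Prop :=
  I ≤ (I ⊓ 𝒜 0) ⊔ (I ⊓ 𝒜 1)

/-- A prime superalgebra: no two nonzero graded left ideals (possibly equal) annihilate each
other. In particular a superalgebra which is prime as an algebra is prime in this sense. -/
def IsPrimeSuperalgebra (m : V →ₗ[F] V →ₗ[F] V) (𝒜 : ZMod 2 → Submodule F V) : Prop :=
  ∀ I J : Submodule F V, IsGradedSubspace 𝒜 I → IsGradedSubspace 𝒜 J →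
    IsLeftIdeal m I → IsLeftIdeal m J → MutuallyAnnihilate m I J → I = ⊥ ∨ J = ⊥

/-- `(V, m)` with the `ℤ/2`-grading `𝒜` is a Lie superalgebra, i.e. its Grassmann envelope is
a Lie algebra (the characteristic is understood to be different from `2`). No extra axiom is
imposed in characteristic `3`, so that algebras with `[y, [y, y]] = 0` for odd `y` are covered
as well as those without this property. -/
structure IsLieSuperalgebra (m : V →ₗ[F] V →ₗ[F] V) (𝒜 : ZMod 2 → Submodule F V) : Prop where
  isInternal : DirectSum.IsInternal 𝒜
  mul_mem : ∀ i j, ∀ x ∈ 𝒜 i, ∀ y ∈ 𝒜 j, m x y ∈ 𝒜 (i + j)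
  skew : ∀ i j, ∀ x ∈ 𝒜 i, ∀ y ∈ 𝒜 j, m x y = -((-1 : F) ^ (i.val * j.val) • m y x)
  jacobi : ∀ i j, ∀ x ∈ 𝒜 i, ∀ y ∈ 𝒜 j, ∀ z,
    m x (m y z) = m (m x y) z + (-1 : F) ^ (i.val * j.val) • m y (m x z)

end Algebras

/-- The multiplication `(x, y) ↦ ⁅x, y⁆` of a Lie algebra as a bilinear map. -/
def lieMul (F L : Type*) [Field F] [LieRing L] [LieAlgebra F L] : L →ₗ[F] L →ₗ[F] L :=
  LinearMap.mk₂ F (fun x y => ⁅x, y⁆) add_lie smul_lie lie_add (fun c x y => lie_smul c x y)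

section Kantor

variable {F A : Type*} [Field F] [AddCommGroup A] [Module F A]

/-- The multiplication of the generalized Kantor double `K(A) = A ⊕ Ax` of an algebra `A` with
multiplication `m` and a second bilinear operation `br`. The pair `(a, b)` stands for `a + bx`;
`a · b = ab`, `a · bx = ax · b = (ab)x`, `ax · bx = {a, b}`. -/
def kantorMul (m br : A →ₗ[F] A →ₗ[F] A) : (A × A) →ₗ[F] (A × A) →ₗ[F] (A × A) :=
  LinearMap.mk₂ F (fun u v => (m u.1 v.1 + br u.2 v.2, m u.1 v.2 + m u.2 v.1))
    (fun u u' v => by ext <;> simp <;> abel)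
    (fun c u v => by ext <;> simp)
    (fun u v v' => by ext <;> simp <;> abel)
    (fun c u v => by ext <;> simp)

/-- A linear map of `K(A)` is even if it preserves the even part `A` and the odd part `Ax`. -/
def IsKantorEven (φ : (A × A) →ₗ[F] (A × A)) : Prop :=
  (∀ a : A, (φ (a, 0)).2 = 0) ∧ (∀ a : A, (φ (0, a)).1 = 0)

/-- The set of even `δ`-derivations of `K(A)`. -/
def kantorEvenDeltaDerivations (m br : A →ₗ[F] A →ₗ[F] A) (δ : F) :
    Set ((A × A) →ₗ[F] (A × A)) :=
  {φ | IsKantorEven φ ∧ φ ∈ deltaDerivations (kantorMul m br) δ}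

/-- The extension of a linear map `ψ` of `A` to `K(A)` by `ax ↦ ψ(a)x`. -/
def kantorExtend (ψ : A →ₗ[F] A) : (A × A) →ₗ[F] (A × A) :=
  ψ.prodMap ψ

end Kantor

/-! Write an even δ-derivation of K(A) as a pair ψ on A, χ on Ax, with δ ≠ 0, 1. Comparing the
products a·b and a·bx, the difference τ = χ - ψ satisfies τ(ab) = δ a τ(b); applying τ to the Jacobi
identity shows that the values of τ kill A², so τ = 0 by primeness. The product ax·bx then says that
ψ is a δ-derivation of the bracket as well. It remains to show that A has no nonzero δ-derivation
when δ ≠ -1, 0, 1/2, 1.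

The parity automorphism σ splits ψ into an even and an odd part. The even part is a superderivation.
The values of all homogeneous δ-superderivations span an ideal J, and any five of them satisfy
((y₀y₁)(y₂y₃))y₄ = 0. Hence ((JJ)(JJ))J = 0, and primeness used three times gives J = 0. The quintic
identity is proved for Lie algebras, where explicit combinations of consequences of the Jacobi
identity leave the factors 2δ - 1 and δ + 1: this is where 1/2 and -1 become exceptional. Adjoining
odd Grassmann variables one at a time carries it over to superalgebras.

The odd part of ψ obeys a Leibniz rule without signs, so it is not a superderivation. This mismatch
of signs kills it on even elements, and its values on odd ones generate a square-zero ideal. -/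

/-! ### Identities for δ-cocycles on Lie algebras -/

section LieCocycle

variable {F L V : Type*} [Field F] [LieRing L] [LieAlgebra F L] [AddCommGroup V] [Module F V]
  [LieRingModule L V] [LieModule F L V]

/-- A `δ`-cocycle on a Lie algebra with values in a module. -/
def IsDeltaCocycle (δ : F) (f : L →ₗ[F] V) : Prop :=
  ∀ a b, f ⁅a, b⁆ = δ • (⁅a, f b⁆ - ⁅b, f a⁆)

/-- Expand f on the Jacobi identity twice: the δ² terms regroup into the cyclic sum and the δ terms
give its negative, so the sum is multiplied by δ² - δ. -/
theorem IsDeltaCocycle.cyclic {δ : F} {f : L →ₗ[F] V} (hf : IsDeltaCocycle δ f) (h0 : δ ≠ 0)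
    (h1 : δ ≠ 1) (a b c : L) : ⁅⁅a, b⁆, f c⁆ + ⁅⁅b, c⁆, f a⁆ + ⁅⁅c, a⁆, f b⁆ = 0 := by
  have hj : f ⁅a, ⁅b, c⁆⁆ + f ⁅b, ⁅c, a⁆⁆ + f ⁅c, ⁅a, b⁆⁆ = 0 := by
    rw [← map_add, ← map_add, lie_jacobi, map_zero]
  have h : (δ * (δ - 1)) • (⁅⁅a, b⁆, f c⁆ + ⁅⁅b, c⁆, f a⁆ + ⁅⁅c, a⁆, f b⁆) = 0 := by
    simp only [hf _ _, lie_lie, lie_sub, lie_smul] at hj ⊢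
    linear_combination (norm := module) hj
  exact (smul_eq_zero.1 h).resolve_left (mul_ne_zero h0 (sub_ne_zero.2 h1))

/-- The action on `V` of the skew-symmetric sum `∑ ± abc` of the universal enveloping algebra. -/
def skewTriple (a b c : L) (v : V) : V :=
  ⁅a, ⁅⁅b, c⁆, v⁆⁆ + ⁅b, ⁅⁅c, a⁆, v⁆⁆ + ⁅c, ⁅⁅a, b⁆, v⁆⁆

/-- An element of degree four of the universal enveloping algebra, acting on `V`, which
annihilates the values of all `δ`-cocycles. -/
def quarticOp (δ : F) (a b c d : L) (v : V) : V :=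
  (δ * (δ - 1)) • (⁅c, skewTriple a b d v⁆ - ⁅d, skewTriple a b c v⁆) +
    δ • (skewTriple a b d ⁅c, v⁆ - skewTriple a b c ⁅d, v⁆) -
    (δ - 1) • ⁅⁅⁅a, b⁆, ⁅c, d⁆⁆, v⁆

set_option maxHeartbeats 4000000 in
theorem IsDeltaCocycle.quarticOp_eq_zero {δ : F} {f : L →ₗ[F] V} (hf : IsDeltaCocycle δ f)
    (h2 : (2 : F) ≠ 0) (h0 : δ ≠ 0) (h1 : δ ≠ 1) (h3 : 2 * δ - 1 ≠ 0) (a b c d x : L) :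
    quarticOp δ a b c d (f x) = 0 := by
  -- Every parenthesis is an instance of `cyclic`, with brackets as arguments or with elements
  -- acting on it. The coefficients are chosen so that, after alternating in a, b and in c, d, the
  -- terms in f a, f b, f c, f d cancel and 4(2δ - 1) times the quartic operator on f x remains.
  have key : ∀ a b c d : L,
      (-2 + 4 * δ - 2 * δ ^ 2) • (⁅⁅⁅⁅a, b⁆, c⁆, d⁆, f x⁆ + ⁅⁅d, x⁆, f ⁅⁅a, b⁆, c⁆⁆ + ⁅⁅x, ⁅⁅a, b⁆, c⁆⁆, f d⁆) +
      (-1 * δ + 1 * δ ^ 2) • (⁅⁅⁅⁅a, b⁆, x⁆, c⁆, f d⁆ + ⁅⁅c, d⁆, f ⁅⁅a, b⁆, x⁆⁆ + ⁅⁅d, ⁅⁅a, b⁆, x⁆⁆, f c⁆) +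
      (2 * δ - 2 * δ ^ 2 + 2 * δ ^ 3) • (⁅⁅⁅a, b⁆, ⁅c, x⁆⁆, f d⁆ + ⁅⁅⁅c, x⁆, d⁆, f ⁅a, b⁆⁆ + ⁅⁅d, ⁅a, b⁆⁆, f ⁅c, x⁆⁆) +
      (-4 + 8 * δ - 4 * δ ^ 2) • (⁅⁅⁅⁅a, c⁆, x⁆, b⁆, f d⁆ + ⁅⁅b, d⁆, f ⁅⁅a, c⁆, x⁆⁆ + ⁅⁅d, ⁅⁅a, c⁆, x⁆⁆, f b⁆) +
      (4 * δ ^ 2) • (⁅⁅⁅⁅a, x⁆, c⁆, b⁆, f d⁆ + ⁅⁅b, d⁆, f ⁅⁅a, x⁆, c⁆⁆ + ⁅⁅d, ⁅⁅a, x⁆, c⁆⁆, f b⁆) +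
      (-4 + 4 * δ + 8 * δ ^ 2 - 4 * δ ^ 3) • (⁅⁅⁅a, c⁆, ⁅b, x⁆⁆, f d⁆ + ⁅⁅⁅b, x⁆, d⁆, f ⁅a, c⁆⁆ + ⁅⁅d, ⁅a, c⁆⁆, f ⁅b, x⁆⁆) +
      (-4 + 4 * δ) • (⁅⁅⁅a, c⁆, b⁆, f ⁅d, x⁆⁆ + ⁅⁅b, ⁅d, x⁆⁆, f ⁅a, c⁆⁆ + ⁅⁅⁅d, x⁆, ⁅a, c⁆⁆, f b⁆) +
      (2 - 2 * δ - 4 * δ ^ 2) • (⁅⁅⁅a, x⁆, b⁆, f ⁅c, d⁆⁆ + ⁅⁅b, ⁅c, d⁆⁆, f ⁅a, x⁆⁆ + ⁅⁅⁅c, d⁆, ⁅a, x⁆⁆, f b⁆) +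
      (1 - 1 * δ - 1 * δ ^ 2) • (⁅⁅a, b⁆, f ⁅⁅c, d⁆, x⁆⁆ + ⁅⁅b, ⁅⁅c, d⁆, x⁆⁆, f a⁆ + ⁅⁅⁅⁅c, d⁆, x⁆, a⁆, f b⁆) +
      (4 * δ - 8 * δ ^ 2 + 4 * δ ^ 3) • ⁅a, (⁅⁅⁅b, c⁆, d⁆, f x⁆ + ⁅⁅d, x⁆, f ⁅b, c⁆⁆ + ⁅⁅x, ⁅b, c⁆⁆, f d⁆)⁆ +
      (-4 * δ ^ 2) • ⁅a, (⁅⁅b, ⁅c, x⁆⁆, f d⁆ + ⁅⁅⁅c, x⁆, d⁆, f b⁆ + ⁅⁅d, b⁆, f ⁅c, x⁆⁆)⁆ +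
      (-4 * δ + 4 * δ ^ 2 + 4 * δ ^ 3) • ⁅c, (⁅⁅⁅a, x⁆, b⁆, f d⁆ + ⁅⁅b, d⁆, f ⁅a, x⁆⁆ + ⁅⁅d, ⁅a, x⁆⁆, f b⁆)⁆ +
      (-2 * δ + 2 * δ ^ 3) • ⁅c, (⁅⁅a, b⁆, f ⁅d, x⁆⁆ + ⁅⁅b, ⁅d, x⁆⁆, f a⁆ + ⁅⁅⁅d, x⁆, a⁆, f b⁆)⁆ +
      (-1 * δ + 2 * δ ^ 2) • ⁅x, (⁅⁅⁅a, b⁆, c⁆, f d⁆ + ⁅⁅c, d⁆, f ⁅a, b⁆⁆ + ⁅⁅d, ⁅a, b⁆⁆, f c⁆)⁆ +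
      (-1 * δ ^ 3) • ⁅x, (⁅⁅a, b⁆, f ⁅c, d⁆⁆ + ⁅⁅b, ⁅c, d⁆⁆, f a⁆ + ⁅⁅⁅c, d⁆, a⁆, f b⁆)⁆ +
      (2 * δ - 4 * δ ^ 2 + 4 * δ ^ 3 - 2 * δ ^ 4) • ⁅a, ⁅b, (⁅⁅c, d⁆, f x⁆ + ⁅⁅d, x⁆, f c⁆ + ⁅⁅x, c⁆, f d⁆)⁆⁆ +
      (-2 * δ ^ 3 + 2 * δ ^ 4) • ⁅c, ⁅x, (⁅⁅a, b⁆, f d⁆ + ⁅⁅b, d⁆, f a⁆ + ⁅⁅d, a⁆, f b⁆)⁆⁆ +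
      (2 * δ ^ 2 - 6 * δ ^ 3 + 2 * δ ^ 4) • ⁅x, ⁅a, (⁅⁅b, c⁆, f d⁆ + ⁅⁅c, d⁆, f b⁆ + ⁅⁅d, b⁆, f c⁆)⁆⁆ = 0 := by
    intro a b c d
    simp only [hf.cyclic h0 h1, lie_zero, smul_zero, add_zero]
  have h : (2 * 2 * (2 * δ - 1)) • quarticOp δ a b c d (f x) = 0 := by
    have k1 := key a b c d
    have k2 := key b a c d
    have k3 := key a b d c
    have k4 := key b a d c
    clear key
    simp only [hf _ _] at k1 k2 k3 k4
    simp only [quarticOp, skewTriple, lie_lie, lie_sub, lie_add, lie_smul, sub_lie] at k1 k2 k3 k4 ⊢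
    linear_combination (norm := module) k1 - k2 - k3 + k4
  exact (smul_eq_zero.1 h).resolve_left (mul_ne_zero (mul_ne_zero h2 h2) h3)

set_option maxHeartbeats 4000000 in
theorem lie_lie_eq_zero_of_quarticOp {δ : F} (h2 : (2 : F) ≠ 0) (h1 : δ ≠ 1)
    (h3 : 2 * δ - 1 ≠ 0) (h4 : δ + 1 ≠ 0) (y : Fin 5 → L)
    (hy : ∀ i, ∀ a b c d : L, quarticOp δ a b c d (y i) = 0) :
    ⁅⁅⁅y 0, y 1⁆, ⁅y 2, y 3⁆⁆, y 4⁆ = 0 := by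
  -- In the adjoint module this turns each term into a word in ad y₀, …, ad y₃ applied to y₄.
  have flip : ∀ z, ⁅y 4, z⁆ = -⁅z, y 4⁆ := fun z => (lie_skew _ _).symm
  -- The eight instances taken below run over the symmetries of ⁅⁅y₀, y₁⁆, ⁅y₂, y₃⁆⁆, with the sign
  -- by which each acts on it; in the signed sum only a multiple of the quintic product survives.
  have key : ∀ p q r s : Fin 5,
      ((δ - 1) * (3 * δ - 1)) • quarticOp δ (y p) (y q) (y r) (y s) (y 4) -
      (2 * (δ - 1) * (3 * δ - 1)) • quarticOp δ (y p) (y q) (y r) (y 4) (y s) -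
      (8 * δ * (δ - 1)) • quarticOp δ (y p) (y r) (y q) (y 4) (y s) -
      (2 * δ ^ 2 - 8 * δ - 2) • quarticOp δ (y p) (y 4) (y r) (y s) (y q) = 0 := by
    intro p q r s
    simp only [hy, smul_zero, sub_zero]
  have h : (2 * 2 * 2 * (2 * δ - 1) * ((δ + 1) * (δ + 1)) * (δ - 1)) •
      ⁅⁅⁅y 0, y 1⁆, ⁅y 2, y 3⁆⁆, y 4⁆ = 0 := by
    have k1 := key 0 1 2 3
    have k2 := key 1 0 2 3
    have k3 := key 0 1 3 2
    have k4 := key 1 0 3 2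
    have k5 := key 2 3 0 1
    have k6 := key 3 2 0 1
    have k7 := key 2 3 1 0
    have k8 := key 3 2 1 0
    clear key
    generalize y 0 = a, y 1 = b, y 2 = c, y 3 = d, y 4 = e at *
    simp only [quarticOp, skewTriple, flip, lie_lie, lie_sub, lie_add, lie_neg, add_lie, sub_lie, neg_lie]
      at k1 k2 k3 k4 k5 k6 k7 k8 ⊢
    linear_combination (norm := module) k1 - k2 - k3 + k4 - k5 + k6 + k7 - k8
  refine (smul_eq_zero.1 h).resolve_left ?_
  have h1' := sub_ne_zero.2 h1
  positivity

end LieCocycle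

/-! ### From Lie algebras to superalgebras: Grassmann variables -/

section Parity

variable {F A : Type*} [Field F] [AddCommGroup A] [Module F A]

/-- A Lie superalgebra `(A, m)` in terms of its parity automorphism `σ`, which is the identity on
the even part and minus the identity on the odd part. -/
structure IsParityLie (m : A →ₗ[F] A →ₗ[F] A) (σ : A →ₗ[F] A) : Prop where
  invol : ∀ a, σ (σ a) = a
  map_mul : ∀ a b, σ (m a b) = m (σ a) (σ b)
  skew_even : ∀ a b, σ a = a → m a b = -m b a
  skew_odd : ∀ a b, σ a = -a → m a b = -m (σ b) a
  jacobi_even : ∀ a b c, σ a = a → m a (m b c) = m (m a b) c + m b (m a c)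
  jacobi_odd : ∀ a b c, σ a = -a → m a (m b c) = m (m a b) c + m (σ b) (m a c)

/-- `x` is homogeneous, of odd parity if `p` is true and of even parity otherwise. -/
def HasParity (σ : A →ₗ[F] A) (p : Bool) (x : A) : Prop :=
  σ x = bif p then -x else x

/-- A homogeneous `δ`-superderivation of parity `p`. -/
structure IsSuperDerivation (m : A →ₗ[F] A →ₗ[F] A) (σ : A →ₗ[F] A) (δ : F) (p : Bool)
    (f : A →ₗ[F] A) : Prop where
  parity : ∀ a, σ (f a) = bif p then -f (σ a) else f (σ a)
  leibniz : ∀ a b, f (m a b) = δ • (m (f a) b + m (bif p then σ a else a) (f b))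

theorem IsSuperDerivation.hasParity {m : A →ₗ[F] A →ₗ[F] A} {σ : A →ₗ[F] A} {δ : F} {p q : Bool}
    {f : A →ₗ[F] A} (hf : IsSuperDerivation m σ δ p f) {x : A} (hx : HasParity σ q x) :
    HasParity σ (xor p q) (f x) := by
  have h := hf.parity x
  cases p <;> cases q <;> simp_all [HasParity]

theorem HasParity.exists_smul {σ : A →ₗ[F] A} {p : Bool} {x : A} (hx : HasParity σ p x) :
    ∃ c : F, c ≠ 0 ∧ σ x = c • x := by
  cases p
  · exact ⟨1, one_ne_zero, by simpa [HasParity] using hx⟩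
  · exact ⟨-1, neg_ne_zero.2 one_ne_zero, by simpa [HasParity] using hx⟩

/-- The multiplication of the superalgebra `A[ξ]` obtained by adjoining an odd Grassmann variable
`ξ`; the pair `(a, b)` stands for `a + ξ b`. -/
def grassmannMul (m : A →ₗ[F] A →ₗ[F] A) (σ : A →ₗ[F] A) : (A × A) →ₗ[F] (A × A) →ₗ[F] (A × A) :=
  LinearMap.mk₂ F (fun u v => (m u.1 v.1, m u.2 v.1 + m (σ u.1) v.2))
    (fun u u' v => by ext <;> simp; abel)
    (fun c u v => by ext <;> simp)
    (fun u v v' => by ext <;> simp; abel)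
    (fun c u v => by ext <;> simp)

/-- The parity automorphism of `A[ξ]`. -/
def grassmannParity (σ : A →ₗ[F] A) : (A × A) →ₗ[F] (A × A) := σ.prodMap (-σ)

@[simp] theorem grassmannMul_apply (m : A →ₗ[F] A →ₗ[F] A) (σ : A →ₗ[F] A) (u v : A × A) :
    grassmannMul m σ u v = (m u.1 v.1, m u.2 v.1 + m (σ u.1) v.2) := rfl

@[simp] theorem grassmannParity_apply (σ : A →ₗ[F] A) (u : A × A) :
    grassmannParity σ u = (σ u.1, -σ u.2) := rfl

/-- Since ξ is odd, a + ξb is even exactly when a is even and b is odd; each axiom splits into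
itself for a and its opposite-parity version for b. -/
theorem IsParityLie.grassmann {m : A →ₗ[F] A →ₗ[F] A} {σ : A →ₗ[F] A} (h : IsParityLie m σ) :
    IsParityLie (grassmannMul m σ) (grassmannParity σ) where
  invol u := by simp [h.invol]
  map_mul u v := by simp [h.map_mul, add_comm]
  skew_even := by
    rintro ⟨a, b⟩ ⟨c, d⟩ hu
    simp only [grassmannParity_apply, Prod.mk.injEq, neg_eq_iff_eq_neg] at hu
    obtain ⟨ha, hb⟩ := hu
    simp only [grassmannMul_apply, Prod.neg_mk, Prod.mk.injEq, ha]
    refine ⟨h.skew_even _ _ ha, ?_⟩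
    rw [h.skew_odd b c hb, h.skew_even a d ha]
    abel
  skew_odd := by
    rintro ⟨a, b⟩ ⟨c, d⟩ hu
    simp only [grassmannParity_apply, Prod.neg_mk, Prod.mk.injEq, neg_inj] at hu
    obtain ⟨ha, hb⟩ := hu
    simp only [grassmannMul_apply, grassmannParity_apply, Prod.neg_mk, Prod.mk.injEq, ha, h.invol,
      map_neg, LinearMap.neg_apply]
    refine ⟨h.skew_odd _ _ ha, ?_⟩
    rw [h.skew_even b c hb, h.skew_odd a d ha]
    abel
  jacobi_even := by
    rintro ⟨a, b⟩ ⟨c, d⟩ ⟨e, f⟩ hu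
    simp only [grassmannParity_apply, Prod.mk.injEq, neg_eq_iff_eq_neg] at hu
    obtain ⟨ha, hb⟩ := hu
    simp only [grassmannMul_apply, Prod.mk_add_mk, Prod.mk.injEq, ha, h.map_mul, map_add,
      LinearMap.add_apply]
    refine ⟨h.jacobi_even _ _ _ ha, ?_⟩
    rw [h.jacobi_odd b c e hb, h.jacobi_even a d e ha, h.jacobi_even a (σ c) f ha]
    abel
  jacobi_odd := by
    rintro ⟨a, b⟩ ⟨c, d⟩ ⟨e, f⟩ hu
    simp only [grassmannParity_apply, Prod.neg_mk, Prod.mk.injEq, neg_inj] at hu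
    obtain ⟨ha, hb⟩ := hu
    simp only [grassmannMul_apply, grassmannParity_apply, Prod.mk_add_mk, Prod.mk.injEq, ha,
      h.map_mul, h.invol, map_add, map_neg, LinearMap.add_apply, LinearMap.neg_apply]
    refine ⟨h.jacobi_odd _ _ _ ha, ?_⟩
    rw [h.jacobi_even b c e hb, h.jacobi_odd a d e ha, h.jacobi_odd a (σ c) f ha, h.invol]
    abel

theorem HasParity.grassmann {σ : A →ₗ[F] A} {p : Bool} {x : A} (hx : HasParity σ p x) :
    HasParity (grassmannParity σ) p (x, 0) := by
  cases p <;> simp_all [HasParity]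

theorem HasParity.grassmann_odd {σ : A →ₗ[F] A} {x : A} (hx : HasParity σ true x) :
    HasParity (grassmannParity σ) false (0, x) := by
  simp_all [HasParity]

/-- The extension of a homogeneous `δ`-superderivation of parity `p` to `A[ξ]`. -/
def grassmannExtend (p : Bool) (f : A →ₗ[F] A) : (A × A) →ₗ[F] (A × A) :=
  f.prodMap (bif p then -f else f)

/-- The product of `ξ` and an odd map, as a map of `A[ξ]`. -/
def grassmannShift (f : A →ₗ[F] A) : (A × A) →ₗ[F] (A × A) :=
  LinearMap.inr F A A ∘ₗ f ∘ₗ LinearMap.fst F A A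

theorem IsSuperDerivation.grassmannExtend {m : A →ₗ[F] A →ₗ[F] A} {σ : A →ₗ[F] A} {δ : F}
    {p : Bool} {f : A →ₗ[F] A} (hf : IsSuperDerivation m σ δ p f) :
    IsSuperDerivation (grassmannMul m σ) (grassmannParity σ) δ p (grassmannExtend p f) where
  parity u := by
    have h := hf.parity
    cases p <;> simp_all [_root_.grassmannExtend]
  leibniz u v := by
    have h := hf.parity
    have h' := hf.leibniz
    cases p
    · simp only [cond_false] at h h'
      simp only [_root_.grassmannExtend, grassmannMul_apply, LinearMap.prodMap_apply, cond_false,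
        map_add, h, h', Prod.mk_add_mk, Prod.smul_mk, Prod.mk.injEq, true_and]
      module
    · simp only [cond_true] at h h'
      simp only [_root_.grassmannExtend, grassmannMul_apply, LinearMap.prodMap_apply, cond_true,
        map_add, h, h', Prod.mk_add_mk, Prod.smul_mk, Prod.mk.injEq, true_and,
        LinearMap.neg_apply, map_neg, grassmannParity_apply]
      module

/-- The sign in the Leibniz rule of an odd f is the one produced by moving ξ past the first factor.
-/
theorem IsSuperDerivation.grassmannShift {m : A →ₗ[F] A →ₗ[F] A} {σ : A →ₗ[F] A} {δ : F}
    {f : A →ₗ[F] A} (hf : IsSuperDerivation m σ δ true f) :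
    IsSuperDerivation (grassmannMul m σ) (grassmannParity σ) δ false (grassmannShift f) where
  parity u := by
    have h := hf.parity
    simp_all [_root_.grassmannShift]
  leibniz u v := by
    have h' := hf.leibniz
    simp_all [_root_.grassmannShift]

/-- The product `((y₀ y₁) (y₂ y₃)) y₄`. -/
def quinticMul (m : A →ₗ[F] A →ₗ[F] A) (y : Fin 5 → A) : A :=
  m (m (m (y 0) (y 1)) (m (y 2) (y 3))) (y 4)

/-- Pulling ξ out to the left past homogeneous factors costs only nonzero scalars. -/
theorem quinticMul_eq_zero_of_grassmann {m : A →ₗ[F] A →ₗ[F] A} {σ : A →ₗ[F] A}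
    (h : IsParityLie m σ) {y : Fin 5 → A} (hy : ∀ j, ∃ c : F, c ≠ 0 ∧ σ (y j) = c • y j)
    (i : Fin 5) (h0 : quinticMul (grassmannMul m σ)
      (fun j => if j = i then (0, y j) else (y j, 0)) = 0) : quinticMul m y = 0 := by
  choose c hc hy using hy
  have h1 := congrArg Prod.snd h0
  fin_cases i <;> simpa [quinticMul, h.map_mul, hy, hc] using h1

/-- On an algebra whose elements in question are all even, the statement reduces to Lie
algebras. -/
theorem quinticMul_eq_zero_of_even {m : A →ₗ[F] A →ₗ[F] A} {σ : A →ₗ[F] A}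
    (h : IsParityLie m σ) {δ : F} (h2 : (2 : F) ≠ 0) (h0 : δ ≠ 0) (h1 : δ ≠ 1)
    (h3 : 2 * δ - 1 ≠ 0) (h4 : δ + 1 ≠ 0) {f : Fin 5 → A →ₗ[F] A} {x : Fin 5 → A}
    (hf : ∀ i, IsSuperDerivation m σ δ false (f i)) (hx : ∀ i, HasParity σ false (x i)) :
    quinticMul m (fun i => f i (x i)) = 0 := by
  let E : Submodule F A := LinearMap.eqLocus σ LinearMap.id
  have hE : ∀ {a}, a ∈ E ↔ σ a = a := Iff.rfl
  have hm : ∀ a b : E, m a b ∈ E := fun a b => by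
    rw [hE, h.map_mul, hE.1 a.2, hE.1 b.2]
  let _ : LieRing E :=
    { (inferInstance : AddCommGroup E) with
      bracket := fun a b => ⟨m a b, hm a b⟩
      add_lie := fun a b c => Subtype.ext (by simp)
      lie_add := fun a b c => Subtype.ext (by simp)
      lie_self := fun a => Subtype.ext (by
        have h5 := h.skew_even a a (hE.1 a.2)
        have h6 : (2 : F) • m a a = 0 := by rw [two_smul]; exact add_eq_zero_iff_eq_neg.2 h5
        simpa [Bracket.bracket, h2] using h6)
      leibniz_lie := fun a b c => Subtype.ext (h.jacobi_even a b c (hE.1 a.2)) }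
  let _ : LieAlgebra F E :=
    { (inferInstance : Module F E) with
      lie_smul := fun t a b => Subtype.ext ((m a).map_smul t b) }
  have hfE : ∀ i, ∀ a ∈ E, f i a ∈ E := fun i a ha => by
    rw [hE, (hf i).parity, hE.1 ha]
    rfl
  have hc : ∀ i, IsDeltaCocycle (L := E) (V := E) δ ((f i).restrict (hfE i)) := fun i a b => by
    apply Subtype.ext
    have h5 := (hf i).leibniz a b
    rw [cond_false, h.skew_even _ _ (hE.1 (hfE i a a.2)), neg_add_eq_sub] at h5
    exact h5
  have key := lie_lie_eq_zero_of_quarticOp (L := E) h2 h1 h3 h4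
    (fun i => (f i).restrict (hfE i) ⟨x i, hx i⟩)
    (fun i a b c d => (hc i).quarticOp_eq_zero h2 h0 h1 h3 a b c d _)
  exact congrArg Subtype.val key

end Parity

/-- Induction on the number n of odd objects among the maps and their arguments: multiplying one of
them by a new odd variable makes it even. -/
theorem quinticMul_superDerivation_eq_zero {F : Type*} [Field F] {δ : F} (h2 : (2 : F) ≠ 0)
    (h0 : δ ≠ 0) (h1 : δ ≠ 1) (h3 : 2 * δ - 1 ≠ 0) (h4 : δ + 1 ≠ 0) (n : ℕ) :
    ∀ {A : Type*} [AddCommGroup A] [Module F A] {m : A →ₗ[F] A →ₗ[F] A} {σ : A →ₗ[F] A}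
      (_ : IsParityLie m σ) {f : Fin 5 → A →ₗ[F] A} {x : Fin 5 → A} {p q : Fin 5 → Bool}
      (_ : ∀ i, IsSuperDerivation m σ δ (p i) (f i)) (_ : ∀ i, HasParity σ (q i) (x i))
      (_ : (Finset.univ.filter (p · = true)).card + (Finset.univ.filter (q · = true)).card = n),
      quinticMul m (fun i => f i (x i)) = 0 := by
  induction n with
  | zero =>
    intro A _ _ m σ h f x p q hf hx hn
    have hp : ∀ i, p i = false := by simpa [Finset.filter_eq_empty_iff] using (add_eq_zero.1 hn).1
    have hq : ∀ i, q i = false := by simpa [Finset.filter_eq_empty_iff] using (add_eq_zero.1 hn).2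
    simp only [hp, hq] at hf hx
    exact quinticMul_eq_zero_of_even h h2 h0 h1 h3 h4 hf hx
  | succ n ih =>
    intro A _ _ m σ h f x p q hf hx hn
    have hy : ∀ j, ∃ c : F, c ≠ 0 ∧ σ (f j (x j)) = c • f j (x j) := fun j =>
      ((hf j).hasParity (hx j)).exists_smul
    have hcard : ∀ (r : Fin 5 → Bool) (i : Fin 5), r i = true →
        (Finset.univ.filter (Function.update r i false · = true)).card + 1 =
          (Finset.univ.filter (r · = true)).card := fun r i hi => by
      rw [← Finset.card_erase_add_one (s := Finset.univ.filter (r · = true)) (a := i)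
        (by simpa using hi)]
      refine congrArg (Finset.card · + 1) (Finset.ext fun j => ?_)
      by_cases hj : j = i <;> simp [hj]
    by_cases hp : ∃ i, p i = true
    · obtain ⟨i, hi⟩ := hp
      refine quinticMul_eq_zero_of_grassmann h hy i ?_
      refine Eq.trans (congrArg _ (funext fun j => ?_)) (ih h.grassmann
        (f := fun j => if j = i then grassmannShift (f j) else grassmannExtend (p j) (f j))
        (x := fun j => (x j, 0)) (p := Function.update p i false) (q := q) (fun j => ?_)
        (fun j => (hx j).grassmann) ?_)
      · by_cases hj : j = i <;> simp [hj, grassmannShift, grassmannExtend]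
      · by_cases hj : j = i
        · subst hj
          simpa using IsSuperDerivation.grassmannShift (hi ▸ hf j)
        · simpa [hj] using (hf j).grassmannExtend
      · have := hcard p i hi
        omega
    · have hp' : ∀ i, p i = false := by simpa using hp
      -- Odd maps are removed first, so that here the extended maps send ξx to ξf(x) without a sign.
      by_cases hq : ∃ i, q i = true
      · obtain ⟨i, hi⟩ := hq
        refine quinticMul_eq_zero_of_grassmann h hy i ?_
        refine Eq.trans (congrArg _ (funext fun j => ?_)) (ih h.grassmann
          (f := fun j => grassmannExtend (p j) (f j))
          (x := fun j => if j = i then (0, x j) else (x j, 0)) (p := p)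
          (q := Function.update q i false) (fun j => (hf j).grassmannExtend) (fun j => ?_) ?_)
        · by_cases hj : j = i <;> simp [hj, grassmannExtend, hp']
        · by_cases hj : j = i
          · subst hj
            simpa using HasParity.grassmann_odd (hi ▸ hx j)
          · simpa [hj] using (hx j).grassmann
        · have := hcard q i hi
          omega
      · have hq' : ∀ i, q i = false := by simpa using hq
        simp [hp', hq'] at hn

/-! ### Consequences of primeness -/

section Prime

variable {F A : Type*} [Field F] [AddCommGroup A] [Module F A]

/-- Primeness of a superalgebra in terms of its parity automorphism `σ`. -/
def IsParityPrime (m : A →ₗ[F] A →ₗ[F] A) (σ : A →ₗ[F] A) : Prop :=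
  ∀ I J : Submodule F A, (∀ x ∈ I, σ x ∈ I) → (∀ x ∈ J, σ x ∈ J) → IsLeftIdeal m I →
    IsLeftIdeal m J → MutuallyAnnihilate m I J → I = ⊥ ∨ J = ⊥

variable {m : A →ₗ[F] A →ₗ[F] A} {σ : A →ₗ[F] A} {δ : F}

theorem IsParityPrime.eq_bot (hp : IsParityPrime m σ) {I : Submodule F A} (hσ : ∀ x ∈ I, σ x ∈ I)
    (hI : IsLeftIdeal m I) (h : ∀ x ∈ I, ∀ y ∈ I, m x y = 0) : I = ⊥ :=
  or_self_iff.1 (hp I I hσ hσ hI hI fun x hx y hy => ⟨h x hx y hy, h y hy x hx⟩)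

theorem IsParityLie.exists_even_add_odd (h : IsParityLie m σ) (h2 : (2 : F) ≠ 0) (a : A) :
    ∃ e o, σ e = e ∧ σ o = -o ∧ a = e + o := by
  refine ⟨(2 : F)⁻¹ • (a + σ a), (2 : F)⁻¹ • (a - σ a), ?_, ?_, ?_⟩
  · simp [h.invol, add_comm]
  · simp [h.invol, ← smul_neg]
  · rw [← smul_add, add_add_sub_cancel, ← two_smul F, inv_smul_smul₀ h2]

theorem IsParityLie.isLeftIdeal_of_homogeneous (h : IsParityLie m σ) (h2 : (2 : F) ≠ 0)
    {I : Submodule F A} (he : ∀ a, σ a = a → ∀ x ∈ I, m a x ∈ I)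
    (ho : ∀ a, σ a = -a → ∀ x ∈ I, m a x ∈ I) : IsLeftIdeal m I := fun a x hx => by
  obtain ⟨e, o, h3, h4, rfl⟩ := h.exists_even_add_odd h2 a
  rw [map_add, LinearMap.add_apply]
  exact I.add_mem (he e h3 x hx) (ho o h4 x hx)

theorem map_eq_zero_of_mem_span {S T : Set A} (h : ∀ x ∈ S, ∀ y ∈ T, m x y = 0) :
    ∀ x ∈ Submodule.span F S, ∀ y ∈ Submodule.span F T, m x y = 0 := by
  intro x hx y hy
  have h1 := Submodule.apply_mem_map₂ m hx hy
  rw [Submodule.map₂_span_span] at h1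
  have h3 : Submodule.span F (Set.image2 (fun x y => m x y) S T) = ⊥ := by
    rw [Submodule.span_eq_bot]
    rintro _ ⟨x, hx, y, hy, rfl⟩
    exact h x hx y hy
  exact (Submodule.mem_bot F).1 (h3 ▸ h1)

theorem map₂_parity_mem (h : IsParityLie m σ) {I : Submodule F A} (hσ : ∀ x ∈ I, σ x ∈ I) :
    ∀ x ∈ Submodule.map₂ m I I, σ x ∈ Submodule.map₂ m I I := by
  suffices Submodule.map₂ m I I ≤ (Submodule.map₂ m I I).comap σ from this
  refine Submodule.map₂_le.2 fun a ha b hb => ?_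
  rw [Submodule.mem_comap, h.map_mul]
  exact Submodule.apply_mem_map₂ m (hσ a ha) (hσ b hb)

theorem IsLeftIdeal.map₂ (h : IsParityLie m σ) (h2 : (2 : F) ≠ 0) {I : Submodule F A}
    (hσ : ∀ x ∈ I, σ x ∈ I) (hI : IsLeftIdeal m I) : IsLeftIdeal m (Submodule.map₂ m I I) := by
  refine h.isLeftIdeal_of_homogeneous h2 (fun c hc => ?_) (fun c hc => ?_)
  all_goals
    suffices Submodule.map₂ m I I ≤ (Submodule.map₂ m I I).comap (m c) from this
    refine Submodule.map₂_le.2 fun a ha b hb => ?_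
    rw [Submodule.mem_comap]
  · rw [h.jacobi_even _ _ _ hc]
    exact add_mem (Submodule.apply_mem_map₂ m (hI c a ha) hb)
      (Submodule.apply_mem_map₂ m ha (hI c b hb))
  · rw [h.jacobi_odd _ _ _ hc]
    exact add_mem (Submodule.apply_mem_map₂ m (hI c a ha) hb)
      (Submodule.apply_mem_map₂ m (hσ a ha) (hI c b hb))

theorem IsLeftIdeal.map₂_le {I : Submodule F A} (hI : IsLeftIdeal m I) :
    Submodule.map₂ m I I ≤ I :=
  Submodule.map₂_le.2 fun a _ b hb => hI a b hb

/-- In a prime Lie superalgebra `A` the annihilator of `A²` is zero. -/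
theorem IsParityPrime.eq_zero_of_mul_eq_zero (hp : IsParityPrime m σ) (h : IsParityLie m σ)
    (h2 : (2 : F) ≠ 0) {w : A} (hw : ∀ x y, m (m x y) w = 0) : w = 0 := by
  let I : Submodule F A := Submodule.map₂ m ⊤ ⊤
  let N : Submodule F A :=
    { carrier := {w | ∀ x y, m (m x y) w = 0}
      add_mem' := fun ha hb x y => by rw [map_add, ha x y, hb x y, add_zero]
      zero_mem' := fun x y => map_zero _
      smul_mem' := fun c a ha x y => by rw [map_smul, ha x y, smul_zero] }
  have hN : ∀ {a}, a ∈ N ↔ ∀ x y, m (m x y) a = 0 := Iff.rfl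
  have hNσ : ∀ a ∈ N, σ a ∈ N := fun a ha x y => by
    have h3 := congrArg σ (ha (σ x) (σ y))
    rwa [map_zero, h.map_mul, h.map_mul, h.invol, h.invol] at h3
  have hIσ : ∀ x ∈ I, σ x ∈ I := map₂_parity_mem h fun _ _ => trivial
  have hIN : ∀ u ∈ I, ∀ a ∈ N, m u a = 0 := by
    intro u hu a ha
    suffices I ≤ LinearMap.ker (m.flip a) from this hu
    exact Submodule.map₂_le.2 fun x _ y _ => ha x y
  have hNI : ∀ a ∈ N, ∀ u ∈ I, m a u = 0 := by
    intro a ha u hu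
    obtain ⟨e, o, he, ho, hs⟩ := h.exists_even_add_odd h2 a
    have h3 : (2 : F) • e = a + σ a := by rw [hs, map_add, he, ho]; module
    have h4 : (2 : F) • o = a - σ a := by rw [hs, map_add, he, ho]; module
    have he' : e ∈ N := (N.smul_mem_iff h2).1 (h3 ▸ N.add_mem ha (hNσ a ha))
    have ho' : o ∈ N := (N.smul_mem_iff h2).1 (h4 ▸ N.sub_mem ha (hNσ a ha))
    rw [hs, map_add, LinearMap.add_apply, h.skew_even e u he, h.skew_odd o u ho, hIN u hu e he',
      hIN _ (hIσ u hu) o ho', neg_zero, add_zero]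
  have hNl : IsLeftIdeal m N := by
    refine h.isLeftIdeal_of_homogeneous h2 (fun z hz a ha x y => ?_) (fun z hz a ha x y => ?_)
    · have h3 := h.jacobi_even z (m x y) a hz
      rw [ha x y, map_zero, ha z _, zero_add] at h3
      exact h3.symm
    · have h3 := h.jacobi_odd z (m (σ x) (σ y)) a hz
      rw [ha _ _, map_zero, ha z _, zero_add, h.map_mul, h.invol, h.invol] at h3
      exact h3.symm
  have hIl : IsLeftIdeal m I := IsLeftIdeal.map₂ h h2 (fun _ _ => trivial) fun _ _ _ => trivial
  rcases hp I N hIσ hNσ hIl hNl (fun u hu a ha => ⟨hIN u hu a ha, hNI a ha u hu⟩) with h3 | h3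
  · have h4 : (⊤ : Submodule F A) = ⊥ := hp.eq_bot (fun _ _ => trivial) (fun _ _ _ => trivial)
      fun x _ y _ => (Submodule.mem_bot F).1 (h3 ▸ Submodule.apply_mem_map₂ m trivial trivial)
    exact (Submodule.mem_bot F).1 (h4 ▸ Submodule.mem_top)
  · exact (Submodule.mem_bot F).1 (h3 ▸ hN.2 hw)

/-- Applying τ to x(yz) = (xy)z ± y(xz) and comparing with the Jacobi identity for x, y, τ(z) gives
δ(δ - 1)(xy)τ(z) = 0, so τ(z) annihilates A². -/
theorem IsParityPrime.eq_zero_of_delta_centroid (hp : IsParityPrime m σ) (h : IsParityLie m σ)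
    (h2 : (2 : F) ≠ 0) (h0 : δ ≠ 0) (h1 : δ ≠ 1) {τ : A →ₗ[F] A}
    (hr : ∀ a b, τ (m a b) = δ • m a (τ b)) : τ = 0 := by
  have key : ∀ x y z : A, δ • m (m x y) (τ z) = 0 := by
    intro x y z
    obtain ⟨e, o, he, ho, rfl⟩ := h.exists_even_add_odd h2 x
    have hr' : ∀ a b c, (δ * δ) • m a (m b (τ c)) = τ (m a (m b c)) := fun a b c => by
      rw [hr, hr, map_smul, smul_smul]
    have h3 : (δ * (δ - 1)) • m (m e y) (τ z) = 0 := by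
      have e1 := h.jacobi_even e y (τ z) he
      have e2 := congrArg τ (h.jacobi_even e y z he)
      rw [map_add, ← hr' e, ← hr' y, hr (m e y) z] at e2
      linear_combination (norm := module) e2 - (δ * δ) • e1
    have h4 : (δ * (δ - 1)) • m (m o y) (τ z) = 0 := by
      have e1 := h.jacobi_odd o y (τ z) ho
      have e2 := congrArg τ (h.jacobi_odd o y z ho)
      rw [map_add, ← hr' o, ← hr' (σ y), hr (m o y) z] at e2
      linear_combination (norm := module) e2 - (δ * δ) • e1
    have h5 : (δ - 1) • δ • m (m (e + o) y) (τ z) = 0 := by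
      simp only [map_add, LinearMap.add_apply]
      linear_combination (norm := module) h3 + h4
    exact (smul_eq_zero.1 h5).resolve_left (sub_ne_zero.2 h1)
  ext z
  exact hp.eq_zero_of_mul_eq_zero h h2 fun x y => (smul_eq_zero.1 (key x y z)).resolve_left h0

/-- The supercommutator of left multiplication by `a` with a `δ`-superderivation is a
`δ`-superderivation. -/
theorem IsSuperDerivation.adjoint (h : IsParityLie m σ) {p r : Bool} {f : A →ₗ[F] A}
    (hf : IsSuperDerivation m σ δ p f) {a : A} (ha : HasParity σ r a) :
    IsSuperDerivation m σ δ (xor r p)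
      (m a ∘ₗ f - (bif r && p then (-1 : F) else 1) • (f ∘ₗ m a)) := by
  obtain ⟨h3, h4⟩ := hf
  cases r <;> cases p <;>
    simp only [HasParity, cond_true, cond_false, Bool.false_xor, Bool.true_xor, Bool.not_true,
      Bool.not_false, Bool.and_true, Bool.and_false] at ha h3 h4 ⊢ <;>
    refine ⟨fun b => ?_, fun b c => ?_⟩ <;>
    simp only [LinearMap.sub_apply, LinearMap.smul_apply, LinearMap.comp_apply, map_sub, map_smul,
      h.map_mul, ha, h3, cond_true, cond_false, map_neg, LinearMap.neg_apply]
  · rw [h.jacobi_even a b c ha, map_add, h4 b c, h4 (m a b) c, h4 b (m a c), map_smul, map_add,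
      h.jacobi_even a (f b) c ha, h.jacobi_even a b (f c) ha]
    module
  · module
  · rw [h.jacobi_even a b c ha, map_add, h4 b c, h4 (m a b) c, h4 b (m a c), map_smul, map_add,
      h.jacobi_even a (f b) c ha, h.jacobi_even a (σ b) (f c) ha, h.map_mul, ha]
    module
  · module
  · rw [h.jacobi_odd a b c ha, map_add, h4 b c, h4 (m a b) c, h4 (σ b) (m a c), map_smul, map_add,
      h.jacobi_odd a (f b) c ha, h.jacobi_odd a b (f c) ha, h3]
    module
  · module
  · rw [h.jacobi_odd a b c ha, map_add, h4 b c, h4 (m a b) c, h4 (σ b) (m a c), map_smul, map_add,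
      h.jacobi_odd a (f b) c ha, h.jacobi_odd a (σ b) (f c) ha, h3, h.map_mul, ha, h.invol]
    simp only [map_neg, LinearMap.neg_apply]
    module

/-- A prime Lie superalgebra has no nonzero `δ`-superderivations for `δ ≠ -1, 0, 1/2, 1`. -/
theorem IsParityPrime.superDerivation_eq_zero (hp : IsParityPrime m σ) (h : IsParityLie m σ)
    (h2 : (2 : F) ≠ 0) (h0 : δ ≠ 0) (h1 : δ ≠ 1) (h3 : 2 * δ - 1 ≠ 0) (h4 : δ + 1 ≠ 0) {p : Bool}
    {f : A →ₗ[F] A} (hf : IsSuperDerivation m σ δ p f) : f = 0 := by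
  -- Both parities are needed: the supercommutator with an odd left multiplication changes the
  -- parity of f.
  let S : Set A := {z | ∃ p q f x, IsSuperDerivation m σ δ p f ∧ HasParity σ q x ∧ f x = z}
  let J : Submodule F A := Submodule.span F S
  have hJσ : ∀ x ∈ J, σ x ∈ J := by
    suffices J ≤ J.comap σ from this
    refine Submodule.span_le.2 ?_
    rintro z ⟨p, q, f, x, hf, hx, rfl⟩
    obtain ⟨c, -, hc⟩ := (hf.hasParity hx).exists_smul
    rw [SetLike.mem_coe, Submodule.mem_comap, hc]
    exact J.smul_mem c (Submodule.subset_span ⟨p, q, f, x, hf, hx, rfl⟩)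
  have hhom : ∀ r a, HasParity σ r a → ∀ z ∈ J, m a z ∈ J := by
    intro r a ha
    suffices J ≤ J.comap (m a) from this
    refine Submodule.span_le.2 ?_
    rintro z ⟨p, q, f, x, hf, hx, rfl⟩
    have h5 : HasParity σ (xor r q) (m a x) := by
      cases r <;> cases q <;> simp_all [HasParity, h.map_mul]
    have h6 : m a (f x) = (m a ∘ₗ f - (bif r && p then (-1 : F) else 1) • (f ∘ₗ m a)) x +
        (bif r && p then (-1 : F) else 1) • f (m a x) := by simp
    rw [SetLike.mem_coe, Submodule.mem_comap, h6]
    exact J.add_mem (Submodule.subset_span ⟨_, _, _, _, hf.adjoint h ha, hx, rfl⟩)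
      (J.smul_mem _ (Submodule.subset_span ⟨_, _, _, _, hf, h5, rfl⟩))
  have hJ : IsLeftIdeal m J := h.isLeftIdeal_of_homogeneous h2 (hhom false) (hhom true)
  have hK := IsLeftIdeal.map₂ h h2 hJσ hJ
  have hKσ := map₂_parity_mem h hJσ
  have hK2 := IsLeftIdeal.map₂ h h2 hKσ hK
  have hK2σ := map₂_parity_mem h hKσ
  have hzero : ∀ x ∈ Submodule.map₂ m (Submodule.map₂ m J J) (Submodule.map₂ m J J), ∀ y ∈ J,
      m x y = 0 := by
    simp only [J, Submodule.map₂_span_span]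
    refine map_eq_zero_of_mem_span ?_
    rintro _ ⟨_, ⟨y0, ⟨p0, q0, f0, x0, hf0, hx0, rfl⟩, y1, ⟨p1, q1, f1, x1, hf1, hx1, rfl⟩, rfl⟩,
      _, ⟨y2, ⟨p2, q2, f2, x2, hf2, hx2, rfl⟩, y3, ⟨p3, q3, f3, x3, hf3, hx3, rfl⟩, rfl⟩, rfl⟩
      y4 ⟨p4, q4, f4, x4, hf4, hx4, rfl⟩
    refine quinticMul_superDerivation_eq_zero h2 h0 h1 h3 h4 _ h (f := ![f0, f1, f2, f3, f4])
      (x := ![x0, x1, x2, x3, x4]) (p := ![p0, p1, p2, p3, p4]) (q := ![q0, q1, q2, q3, q4])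
      (fun i => ?_) (fun i => ?_) rfl
    · fin_cases i <;> assumption
    · fin_cases i <;> assumption
  -- With K = JJ, the ideal KK lies in J and annihilates J, hence is zero; then K and J are
  -- square-zero in turn.
  have e1 := hp.eq_bot hK2σ hK2 fun x hx y hy => hzero x hx y (hJ.map₂_le (hK.map₂_le hy))
  have e2 := hp.eq_bot hKσ hK fun x hx y hy =>
    (Submodule.mem_bot F).1 (e1 ▸ Submodule.apply_mem_map₂ m hx hy)
  have e3 := hp.eq_bot hJσ hJ fun x hx y hy =>
    (Submodule.mem_bot F).1 (e2 ▸ Submodule.apply_mem_map₂ m hx hy)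
  have e4 : ∀ q x, HasParity σ q x → f x = 0 := fun q x hx =>
    (Submodule.mem_bot F).1 (e3 ▸ Submodule.subset_span ⟨p, q, f, x, hf, hx, rfl⟩)
  ext x
  obtain ⟨e, o, he, ho, rfl⟩ := h.exists_even_add_odd h2 x
  rw [map_add, e4 false e he, e4 true o ho, add_zero, LinearMap.zero_apply]

end Prime

/-! ### Odd δ-derivations with the unsigned Leibniz rule -/

section OddDerivation

variable {F A : Type*} [Field F] [AddCommGroup A] [Module F A] {m : A →ₗ[F] A →ₗ[F] A}
  {σ : A →ₗ[F] A} {δ : F}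

/-- An odd `δ`-derivation (in the ordinary sense) of a prime Lie superalgebra vanishes on the even
part. -/
theorem IsParityPrime.odd_deltaDerivation_apply_even (hp : IsParityPrime m σ)
    (h : IsParityLie m σ) (h2 : (2 : F) ≠ 0) (h0 : δ ≠ 0) {E : A →ₗ[F] A}
    (hE : E ∈ deltaDerivations m δ) (hσ : ∀ a, σ (E a) = -E (σ a)) {a : A} (ha : σ a = a) :
    E a = 0 := by
  -- Even elements preserve this space and odd ones kill it, so it is a square-zero ideal.
  let I : Submodule F A :=
    { carrier := {w | σ w = -w ∧ ∀ y, σ y = -y → m w y = 0}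
      add_mem' := by
        rintro a b ⟨ha, ha'⟩ ⟨hb, hb'⟩
        refine ⟨by rw [map_add, ha, hb, neg_add], fun y hy => ?_⟩
        rw [map_add, LinearMap.add_apply, ha' y hy, hb' y hy, add_zero]
      zero_mem' := by simp
      smul_mem' := by
        rintro c a ⟨ha, ha'⟩
        refine ⟨by rw [map_smul, ha, smul_neg], fun y hy => ?_⟩
        rw [map_smul, LinearMap.smul_apply, ha' y hy, smul_zero] }
  have hI : I = ⊥ := by
    refine hp.eq_bot (fun w hw => ?_) ?_ fun x hx y hy => hx.2 y hy.1
    · rw [hw.1]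
      exact I.neg_mem hw
    · refine h.isLeftIdeal_of_homogeneous h2 (fun e he w hw => ⟨?_, fun y hy => ?_⟩)
        (fun o ho w hw => ?_)
      · rw [h.map_mul, he, hw.1, map_neg]
      · have h3 := h.jacobi_even e w y he
        rw [hw.2 y hy, hw.2 (m e y) (by rw [h.map_mul, he, hy, map_neg]), map_zero, add_zero] at h3
        exact h3.symm
      · rw [h.skew_odd o w ho, hw.1, map_neg, LinearMap.neg_apply, neg_neg, hw.2 o ho]
        exact I.zero_mem
  have hEa : σ (E a) = -E a := by rw [hσ, ha]
  have key : E a ∈ I := by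
    refine ⟨hEa, fun y hy => ?_⟩
    have e1 := hE a y
    have e2 := hE y a
    have hEy : σ (E y) = E y := by rw [hσ, hy, map_neg, neg_neg]
    have e3 := h.skew_odd y (E a) hy
    rw [hEa, map_neg, LinearMap.neg_apply, neg_neg] at e3
    rw [h.skew_even (E y) a hEy, e3, (neg_eq_iff_eq_neg.2 (h.skew_even a y ha)).symm, map_neg] at e2
    -- Here ay = -ya and aE(y) = -E(y)a, but E(a)y = yE(a) since both factors are odd; adding E(ay)
    -- and E(ya) leaves only this term.
    have e4 : (2 * δ) • m (E a) y = 0 := by linear_combination (norm := module) -e1 - e2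
    exact (smul_eq_zero.1 e4).resolve_left (mul_ne_zero h2 h0)
  rw [hI] at key
  exact (Submodule.mem_bot F).1 key

/-- A prime Lie superalgebra has no nonzero odd `δ`-derivations (in the ordinary sense) for
`δ ≠ 0, 1`. -/
theorem IsParityPrime.odd_deltaDerivation_eq_zero (hp : IsParityPrime m σ)
    (h : IsParityLie m σ) (h2 : (2 : F) ≠ 0) (h0 : δ ≠ 0) (h1 : δ ≠ 1) {E : A →ₗ[F] A}
    (hE : E ∈ deltaDerivations m δ) (hσ : ∀ a, σ (E a) = -E (σ a)) : E = 0 := by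
  have hev : ∀ {a}, σ a = a → E a = 0 := hp.odd_deltaDerivation_apply_even h h2 h0 hE hσ
  have hE0 : ∀ {y}, σ y = -y → σ (E y) = E y := fun {y} hy => by rw [hσ, hy, map_neg, neg_neg]
  have oddmul : ∀ {x y}, σ x = -x → σ y = -y → m x y = m y x := fun {x y} hx hy => by
    rw [h.skew_odd x y hx, hy, map_neg, LinearMap.neg_apply, neg_neg]
  have evenodd : ∀ {x y}, σ x = x → σ y = -y → σ (m x y) = -m x y := fun {x y} hx hy => by
    rw [h.map_mul, hx, hy, map_neg]
  have oddodd : ∀ {x y}, σ x = -x → σ y = -y → σ (m x y) = m x y := fun {x y} hx hy => by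
    rw [h.map_mul, hx, hy, map_neg, map_neg, LinearMap.neg_apply, neg_neg]
  have jac : ∀ {x y}, σ x = -x → σ y = -y → ∀ z, m x (m y z) = m (m x y) z - m y (m x z) :=
    fun {x y} hx hy z => by
      rw [h.jacobi_odd x y z hx, hy, map_neg, LinearMap.neg_apply, sub_eq_add_neg]
  have leib : ∀ {x}, σ x = x → ∀ y, E (m x y) = δ • m x (E y) := fun {x} hx y => by
    rw [hE, hev hx, map_zero, LinearMap.zero_apply, zero_add]
  have leib' : ∀ {x}, σ x = x → ∀ y, m x (E y) = δ⁻¹ • E (m x y) := fun {x} hx y => by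
    rw [leib hx, inv_smul_smul₀ h0]
  -- `m (E w) y` is symmetric in the odd elements `w`, `y`.
  have symm : ∀ {w y}, σ w = -w → σ y = -y → m (E w) y = m (E y) w := fun {w y} hw hy => by
    have e1 := hE w y
    rw [hev (oddodd hw hy), h.skew_odd w (E y) hw, hE0 hy, ← sub_eq_add_neg] at e1
    exact sub_eq_zero.1 ((smul_eq_zero.1 e1.symm).resolve_left h0)
  have comm : ∀ {w y}, σ w = -w → σ y = -y → m (E w) (E y) = 0 := fun {w y} hw hy => by
    have e1 := congrArg E (symm hw hy)
    rw [leib (hE0 hw), leib (hE0 hy), h.skew_even (E y) (E w) (hE0 hy)] at e1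
    have e2 : (2 * δ) • m (E w) (E y) = 0 := by linear_combination (norm := module) e1
    exact (smul_eq_zero.1 e2).resolve_left (mul_ne_zero h2 h0)
  have act : ∀ {x w y}, σ x = x → σ w = -w → σ y = -y →
      m x (m (E w) y) = δ⁻¹ • m (E (m x w)) y + m (E w) (m x y) := fun {x w y} hx hw hy => by
    rw [h.jacobi_even x (E w) y hx, leib' hx, map_smul, LinearMap.smul_apply]
  have triple : ∀ {v w y}, σ v = -v → σ w = -w → σ y = -y → m (E v) (m (E w) y) = 0 := by
    -- the trilinear expression is invariant and, up to the factor `1 + δ⁻¹`, also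
    -- multiplied when `v` and `w` are interchanged
    have shift : ∀ {x w y}, σ x = x → σ w = -w → σ y = -y →
        m x (m (E w) y) = (1 + δ⁻¹) • m (E w) (m x y) := fun {x w y} hx hw hy => by
      have e1 := act hx hw hy
      have e2 := act hx hy hw
      rw [symm (evenodd hx hw) hy] at e1
      rw [symm (evenodd hx hy) hw, ← symm hw hy] at e2
      have e3 : (δ⁻¹ * (1 - δ)) • (m (E y) (m x w) - m (E w) (m x y)) = 0 := by
        have e4 := e1.symm.trans e2
        have e5 : δ⁻¹ * (1 - δ) = δ⁻¹ - 1 := by field_simp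
        rw [e5]
        linear_combination (norm := module) e4
      have e6 := (smul_eq_zero.1 e3).resolve_left
        (mul_ne_zero (inv_ne_zero h0) (sub_ne_zero.2 h1.symm))
      rw [e1, sub_eq_zero.1 e6]
      module
    intro v w y hv hw hy
    -- With x = E v, and since E v and E w commute as operators, the element equals 1 + δ⁻¹ times
    -- itself.
    have e1 := shift (hE0 hv) hw hy
    have e2 := h.jacobi_even (E v) (E w) y (hE0 hv)
    rw [comm hv hw, map_zero, LinearMap.zero_apply, zero_add] at e2
    rw [← e2] at e1
    have e3 : δ⁻¹ • m (E v) (m (E w) y) = 0 := by linear_combination (norm := module) -e1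
    exact (smul_eq_zero.1 e3).resolve_left (inv_ne_zero h0)
  have rot : ∀ {w y z}, σ w = -w → σ y = -y → σ z = -z →
      m (m y z) (E w) = m (m (E y) z) w := by
    have e1 : ∀ {w y z}, σ w = -w → σ y = -y → σ z = -z →
        m (m y z) (E w) = -(m (m (E w) z) y + m (m (E w) y) z) := fun {w y z} hw hy hz => by
      have e2 := jac hy hz (E w)
      have e3 : ∀ {t}, σ t = -t → m t (E w) = -m (E w) t := fun {t} ht => by
        rw [h.skew_odd t (E w) ht, hE0 hw]
      rw [e3 hz, e3 hy, map_neg, map_neg, oddmul hy (evenodd (hE0 hw) hz),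
        oddmul hz (evenodd (hE0 hw) hy)] at e2
      linear_combination (norm := module) -e2
    intro w y z hw hy hz
    -- The Jacobi identity for three odd elements; E passes to the last factor because it vanishes
    -- on the even products.
    have e2 : m (m y z) w + m (m z w) y + m (m w y) z = 0 := by
      have e3 := jac hy hz w
      rw [h.skew_odd y (m z w) hy, oddodd hz hw, h.skew_odd z (m y w) hz, oddodd hy hw,
        oddmul hy hw] at e3
      linear_combination (norm := module) -e3
    have e4 := congrArg E e2
    rw [map_add, map_add, leib (oddodd hy hz), leib (oddodd hz hw), leib (oddodd hw hy), map_zero,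
      e1 hw hy hz, e1 hy hz hw, e1 hz hw hy, symm hw hy, symm hw hz, symm hz hy] at e4
    have e5 : (2 * δ) • (m (m (E z) w) y + m (m (E y) w) z + m (m (E y) z) w) = 0 := by
      linear_combination (norm := module) -e4
    have e6 := (smul_eq_zero.1 e5).resolve_left (mul_ne_zero h2 h0)
    rw [e1 hw hy hz, symm hw hy, symm hw hz]
    linear_combination (norm := module) -e6
  let S : Set A := {z | ∃ w, σ w = -w ∧ E w = z}
  let T : Set A := {z | ∃ w y, σ w = -w ∧ σ y = -y ∧ m (E w) y = z}
  let I : Submodule F A := Submodule.span F (S ∪ T)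
  have hS : ∀ {w}, σ w = -w → E w ∈ I := fun {w} hw => Submodule.subset_span (Or.inl ⟨w, hw, rfl⟩)
  have hT : ∀ {w y}, σ w = -w → σ y = -y → m (E w) y ∈ I := fun {w y} hw hy =>
    Submodule.subset_span (Or.inr ⟨w, y, hw, hy, rfl⟩)
  have hI : I = ⊥ := by
    refine hp.eq_bot ?_ (h.isLeftIdeal_of_homogeneous h2 ?_ ?_) (map_eq_zero_of_mem_span ?_)
    · suffices I ≤ I.comap σ from this
      refine Submodule.span_le.2 ?_
      rintro _ (⟨w, hw, rfl⟩ | ⟨w, y, hw, hy, rfl⟩) <;> rw [SetLike.mem_coe, Submodule.mem_comap]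
      · exact (hE0 hw).symm ▸ hS hw
      · exact (evenodd (hE0 hw) hy).symm ▸ I.neg_mem (hT hw hy)
    · intro x hx
      suffices I ≤ I.comap (m x) from this
      refine Submodule.span_le.2 ?_
      rintro _ (⟨w, hw, rfl⟩ | ⟨w, y, hw, hy, rfl⟩) <;> rw [SetLike.mem_coe, Submodule.mem_comap]
      · rw [leib' hx]
        exact I.smul_mem _ (hS (evenodd hx hw))
      · rw [act hx hw hy]
        exact I.add_mem (I.smul_mem _ (hT (evenodd hx hw) hy)) (hT hw (evenodd hx hy))
    · intro x hx
      suffices I ≤ I.comap (m x) from this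
      refine Submodule.span_le.2 ?_
      rintro _ (⟨w, hw, rfl⟩ | ⟨w, y, hw, hy, rfl⟩) <;> rw [SetLike.mem_coe, Submodule.mem_comap]
      · rw [h.skew_odd x (E w) hx, hE0 hw]
        exact I.neg_mem (hT hw hx)
      -- By `rot` this product is (wy)E(x), again a multiple of a value of E.
      · rw [oddmul hx (evenodd (hE0 hw) hy), ← rot hx hw hy, leib' (oddodd hw hy)]
        exact I.smul_mem _ (hS (evenodd (oddodd hw hy) hx))
    · rintro _ (⟨w, hw, rfl⟩ | ⟨w, y, hw, hy, rfl⟩) _ (⟨v, hv, rfl⟩ | ⟨v, z, hv, hz, rfl⟩)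
      · exact comm hw hv
      · exact triple hw hv hz
      · have e1 := h.skew_even (E v) (m (E w) y) (hE0 hv)
        rw [triple hv hw hy] at e1
        exact neg_eq_zero.1 e1.symm
      · have e1 := h.jacobi_even (E w) y (m (E v) z) (hE0 hw)
        rw [triple hw hv hz, map_zero, add_zero, oddmul hy (evenodd (hE0 hv) hz), ← rot hy hv hz,
          leib' (oddodd hv hz), map_smul, comm hw (evenodd (oddodd hv hz) hy), smul_zero] at e1
        exact e1.symm
  ext a
  obtain ⟨e, o, he, ho, rfl⟩ := h.exists_even_add_odd h2 a
  have h3 := hS ho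
  rw [hI] at h3
  rw [map_add, hev he, (Submodule.mem_bot F).1 h3, add_zero, LinearMap.zero_apply]

end OddDerivation

/-! ### Gradings as parity automorphisms -/

section Grading

variable {F A : Type*} [Field F] [AddCommGroup A] [Module F A] {m : A →ₗ[F] A →ₗ[F] A}
  {𝒜 : ZMod 2 → Submodule F A}

theorem IsLieSuperalgebra.isCompl (h : IsLieSuperalgebra m 𝒜) : IsCompl (𝒜 0) (𝒜 1) :=
  (DirectSum.isInternal_submodule_iff_isCompl 𝒜 (by decide) (Set.eq_univ_of_forall fun i => by
    fin_cases i
    exacts [Or.inl rfl, Or.inr rfl]).symm).1 h.isInternal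

/-- The parity automorphism of a Lie superalgebra. -/
noncomputable def IsLieSuperalgebra.parity (h : IsLieSuperalgebra m 𝒜) : A →ₗ[F] A :=
  LinearMap.ofIsCompl h.isCompl (𝒜 0).subtype (-(𝒜 1).subtype)

theorem IsLieSuperalgebra.parity_of_mem_zero (h : IsLieSuperalgebra m 𝒜) {x : A} (hx : x ∈ 𝒜 0) :
    h.parity x = x :=
  LinearMap.ofIsCompl_apply_left h.isCompl (⟨x, hx⟩ : 𝒜 0)

theorem IsLieSuperalgebra.parity_of_mem_one (h : IsLieSuperalgebra m 𝒜) {x : A} (hx : x ∈ 𝒜 1) :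
    h.parity x = -x :=
  LinearMap.ofIsCompl_apply_right h.isCompl (⟨x, hx⟩ : 𝒜 1)

theorem IsLieSuperalgebra.exists_add (h : IsLieSuperalgebra m 𝒜) (x : A) :
    ∃ e ∈ 𝒜 0, ∃ o ∈ 𝒜 1, e + o = x :=
  Submodule.mem_sup.1 (h.isCompl.sup_eq_top ▸ Submodule.mem_top)

theorem IsLieSuperalgebra.mem_zero (h : IsLieSuperalgebra m 𝒜) (h2 : (2 : F) ≠ 0) {x : A}
    (hx : h.parity x = x) : x ∈ 𝒜 0 := by
  obtain ⟨e, he, o, ho, rfl⟩ := h.exists_add x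
  rw [map_add, h.parity_of_mem_zero he, h.parity_of_mem_one ho] at hx
  have h3 : (2 : F) • o = 0 := by linear_combination (norm := module) -hx
  rw [(smul_eq_zero.1 h3).resolve_left h2, add_zero]
  exact he

theorem IsLieSuperalgebra.mem_one (h : IsLieSuperalgebra m 𝒜) (h2 : (2 : F) ≠ 0) {x : A}
    (hx : h.parity x = -x) : x ∈ 𝒜 1 := by
  obtain ⟨e, he, o, ho, rfl⟩ := h.exists_add x
  rw [map_add, h.parity_of_mem_zero he, h.parity_of_mem_one ho] at hx
  have h3 : (2 : F) • e = 0 := by linear_combination (norm := module) hx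
  rw [(smul_eq_zero.1 h3).resolve_left h2, zero_add]
  exact ho

theorem IsLieSuperalgebra.isParityLie (h : IsLieSuperalgebra m 𝒜) (h2 : (2 : F) ≠ 0) :
    IsParityLie m h.parity where
  invol a := by
    obtain ⟨e, he, o, ho, rfl⟩ := h.exists_add a
    simp [h.parity_of_mem_zero he, h.parity_of_mem_one ho]
  map_mul a b := by
    obtain ⟨e, he, o, ho, rfl⟩ := h.exists_add a
    obtain ⟨e', he', o', ho', rfl⟩ := h.exists_add b
    have h00 := h.parity_of_mem_zero (h.mul_mem 0 0 e he e' he')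
    have h01 := h.parity_of_mem_one (h.mul_mem 0 1 e he o' ho')
    have h10 := h.parity_of_mem_one (h.mul_mem 1 0 o ho e' he')
    have h11 := h.parity_of_mem_zero (h.mul_mem 1 1 o ho o' ho')
    simp [h.parity_of_mem_zero he, h.parity_of_mem_one ho, h.parity_of_mem_zero he',
      h.parity_of_mem_one ho', h00, h01, h10, h11, add_comm]
  skew_even a b ha := by
    obtain ⟨e, he, o, ho, rfl⟩ := h.exists_add b
    have h3 := h.skew 0 0 a (h.mem_zero h2 ha) e he
    have h4 := h.skew 0 1 a (h.mem_zero h2 ha) o ho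
    simp only [ZMod.val_zero, zero_mul, pow_zero, one_smul] at h3 h4
    rw [map_add, map_add, LinearMap.add_apply, h3, h4, neg_add]
  skew_odd a b ha := by
    obtain ⟨e, he, o, ho, rfl⟩ := h.exists_add b
    have h3 := h.skew 1 0 a (h.mem_one h2 ha) e he
    have h4 := h.skew 1 1 a (h.mem_one h2 ha) o ho
    simp only [ZMod.val_zero, mul_zero, pow_zero, one_smul, ZMod.val_one, mul_one, pow_one,
      neg_smul] at h3 h4
    rw [map_add, map_add, map_add, LinearMap.add_apply, h3, h4, h.parity_of_mem_zero he,
      h.parity_of_mem_one ho, neg_add, map_neg, LinearMap.neg_apply]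
  jacobi_even a b c ha := by
    obtain ⟨e, he, o, ho, rfl⟩ := h.exists_add b
    have h3 := h.jacobi 0 0 a (h.mem_zero h2 ha) e he c
    have h4 := h.jacobi 0 1 a (h.mem_zero h2 ha) o ho c
    simp only [ZMod.val_zero, zero_mul, pow_zero, one_smul] at h3 h4
    simp only [map_add, LinearMap.add_apply, h3, h4]
    abel
  jacobi_odd a b c ha := by
    obtain ⟨e, he, o, ho, rfl⟩ := h.exists_add b
    have h3 := h.jacobi 1 0 a (h.mem_one h2 ha) e he c
    have h4 := h.jacobi 1 1 a (h.mem_one h2 ha) o ho c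
    simp only [ZMod.val_zero, mul_zero, pow_zero, one_smul, ZMod.val_one, mul_one, pow_one,
      neg_smul] at h3 h4
    simp only [map_add, LinearMap.add_apply, h3, h4, h.parity_of_mem_zero he,
      h.parity_of_mem_one ho, map_neg, LinearMap.neg_apply]
    abel

theorem IsLieSuperalgebra.isGradedSubspace (h : IsLieSuperalgebra m 𝒜) (h2 : (2 : F) ≠ 0)
    {I : Submodule F A} (hI : ∀ x ∈ I, h.parity x ∈ I) : IsGradedSubspace 𝒜 I := fun x hx => by
  have hx' := hI x hx
  obtain ⟨e, he, o, ho, rfl⟩ := h.exists_add x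
  rw [map_add, h.parity_of_mem_zero he, h.parity_of_mem_one ho] at hx'
  have h3 : (2 : F) • e ∈ I := by
    convert I.add_mem hx hx' using 1
    module
  have h4 : (2 : F) • o ∈ I := by
    convert I.sub_mem hx hx' using 1
    module
  exact Submodule.add_mem_sup ⟨(I.smul_mem_iff h2).1 h3, he⟩ ⟨(I.smul_mem_iff h2).1 h4, ho⟩

theorem IsPrimeSuperalgebra.isParityPrime (hp : IsPrimeSuperalgebra m 𝒜)
    (h : IsLieSuperalgebra m 𝒜) (h2 : (2 : F) ≠ 0) : IsParityPrime m h.parity :=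
  fun I J hI hJ => hp I J (h.isGradedSubspace h2 hI) (h.isGradedSubspace h2 hJ)

/-- With σ the identity, the signed axioms reduce to the ordinary Lie ones. -/
theorem isParityLie_lieMul {F : Type*} [Field F] (h2 : (2 : F) ≠ 0) (L : Type*) [LieRing L]
    [LieAlgebra F L] : IsParityLie (lieMul F L) LinearMap.id := by
  have h0 : ∀ a : L, a = -a → a = 0 := fun a ha => by
    have h3 : (2 : F) • a = 0 := by linear_combination (norm := module) ha
    exact (smul_eq_zero.1 h3).resolve_left h2
  exact {
    invol := fun _ => rfl
    map_mul := fun _ _ => rfl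
    skew_even := fun a b _ => (lie_skew a b).symm
    skew_odd := fun a b _ => (lie_skew a b).symm
    jacobi_even := fun a b c _ => leibniz_lie a b c
    jacobi_odd := fun a b c _ => leibniz_lie a b c }

theorem IsPrimeAlgebra.isParityPrime (hp : IsPrimeAlgebra m) : IsParityPrime m LinearMap.id :=
  fun I J _ _ => hp I J

end Grading

/-! ### δ-derivations of A and of its Kantor double -/

section KantorDouble

variable {F A : Type*} [Field F] [AddCommGroup A] [Module F A] {m br : A →ₗ[F] A →ₗ[F] A}
  {σ : A →ₗ[F] A} {δ : F}

/-- A prime Lie superalgebra has no nonzero `δ`-derivations (in the ordinary sense) unless `δ` is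
`0`, `1`, `1 / 2` or `-1`. -/
theorem IsParityPrime.deltaDerivation_eq_zero (hp : IsParityPrime m σ) (h : IsParityLie m σ)
    (h2 : (2 : F) ≠ 0) (h0 : δ ≠ 0) (h1 : δ ≠ 1) (h3 : 2 * δ - 1 ≠ 0) (h4 : δ + 1 ≠ 0)
    {ψ : A →ₗ[F] A} (hψ : ψ ∈ deltaDerivations m δ) : ψ = 0 := by
  have hσ : ∀ a b, (σ ∘ₗ ψ ∘ₗ σ) (m a b) =
      δ • (m ((σ ∘ₗ ψ ∘ₗ σ) a) b + m a ((σ ∘ₗ ψ ∘ₗ σ) b)) := fun a b => by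
    simp [h.map_mul, hψ (σ a) (σ b), h.invol]
  -- Twice the even part of ψ, where ordinary and super Leibniz rules agree; the next difference is
  -- twice the odd part, where they do not.
  have e0 : ψ + σ ∘ₗ ψ ∘ₗ σ = 0 := by
    refine hp.superDerivation_eq_zero h h2 h0 h1 h3 h4 (p := false) ⟨fun a => ?_, fun a b => ?_⟩
    · simp [h.invol, add_comm]
    · simp only [LinearMap.add_apply, hψ a b, hσ a b, map_add, cond_false]
      module
  have e1 : ψ - σ ∘ₗ ψ ∘ₗ σ = 0 := by
    refine hp.odd_deltaDerivation_eq_zero h h2 h0 h1 (fun a b => ?_) fun a => ?_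
    · simp only [LinearMap.sub_apply, hψ a b, hσ a b, map_sub]
      module
    · simp [h.invol]
  have e2 : (2 : F) • ψ = 0 := by linear_combination (norm := module) e0 + e1
  exact (smul_eq_zero.1 e2).resolve_left h2

theorem kantorExtend_mem_kantorEvenDeltaDerivations {ψ : A →ₗ[F] A}
    (h : ψ ∈ deltaDerivations m δ) (h' : ψ ∈ deltaDerivations br δ) :
    kantorExtend ψ ∈ kantorEvenDeltaDerivations m br δ := by
  refine ⟨⟨fun a => map_zero ψ, fun a => map_zero ψ⟩, fun u v => Prod.ext ?_ ?_⟩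
  · simp only [kantorMul, kantorExtend, LinearMap.mk₂_apply, LinearMap.prodMap_apply, map_add,
      h u.1 v.1, h' u.2 v.2, Prod.smul_fst, Prod.fst_add]
    module
  · simp only [kantorMul, kantorExtend, LinearMap.mk₂_apply, LinearMap.prodMap_apply, map_add,
      h u.1 v.2, h u.2 v.1, Prod.smul_snd, Prod.snd_add]
    module

theorem IsParityPrime.exists_eq_kantorExtend (hp : IsParityPrime m σ) (h : IsParityLie m σ)
    (h2 : (2 : F) ≠ 0) (h0 : δ ≠ 0) (h1 : δ ≠ 1) {φ : (A × A) →ₗ[F] (A × A)}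
    (hφ : φ ∈ kantorEvenDeltaDerivations m br δ) :
    ∃ ψ ∈ deltaDerivations m δ ∩ deltaDerivations br δ, kantorExtend ψ = φ := by
  obtain ⟨⟨hl, hr⟩, hd⟩ := hφ
  let ψ : A →ₗ[F] A := LinearMap.fst F A A ∘ₗ φ ∘ₗ LinearMap.inl F A A
  let χ : A →ₗ[F] A := LinearMap.snd F A A ∘ₗ φ ∘ₗ LinearMap.inr F A A
  have hl' : ∀ a, φ (a, 0) = (ψ a, 0) := fun a => Prod.ext rfl (hl a)
  have hr' : ∀ a, φ (0, a) = (0, χ a) := fun a => Prod.ext (hr a) rfl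
  have d00 : ∀ a b, ψ (m a b) = δ • (m (ψ a) b + m a (ψ b)) := fun a b => by
    have e := congrArg Prod.fst (hd (a, 0) (b, 0))
    simpa [kantorMul, hl'] using e
  have d01 : ∀ a b, χ (m a b) = δ • (m (ψ a) b + m a (χ b)) := fun a b => by
    have e := congrArg Prod.snd (hd (a, 0) (0, b))
    simpa [kantorMul, hl', hr'] using e
  have d11 : ∀ a b, ψ (br a b) = δ • (br (χ a) b + br a (χ b)) := fun a b => by
    have e := congrArg Prod.fst (hd (0, a) (0, b))
    simpa [kantorMul, hl', hr'] using e
  have hχ : χ = ψ := by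
    refine sub_eq_zero.1 (hp.eq_zero_of_delta_centroid h h2 h0 h1 fun a b => ?_)
    rw [LinearMap.sub_apply, LinearMap.sub_apply, d00, d01, map_sub]
    module
  rw [hχ] at d11
  refine ⟨ψ, ⟨d00, d11⟩, LinearMap.prod_ext ?_ ?_⟩
  · ext a
    · rfl
    · exact (map_zero ψ).trans (hl a).symm
  · ext a
    · exact (map_zero ψ).trans (hr a).symm
    · exact (LinearMap.congr_fun hχ a).symm

theorem IsParityPrime.eq_of_isNontrivialDeltaDerivation (hp : IsParityPrime m σ)
    (h : IsParityLie m σ) (h2 : (2 : F) ≠ 0) {φ : (A × A) →ₗ[F] (A × A)} (he : IsKantorEven φ)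
    (hφ : IsNontrivialDeltaDerivation (kantorMul m br) δ φ) : δ = 1 / 2 ∨ δ = -1 := by
  obtain ⟨hd, hne, h0, h1, -⟩ := hφ
  obtain ⟨ψ, hψ, rfl⟩ := hp.exists_eq_kantorExtend h h2 h0 h1 ⟨he, hd⟩
  by_contra! hδ
  have h3 : 2 * δ - 1 ≠ 0 := fun e => hδ.1 ((eq_div_iff h2).2 (by linear_combination e))
  have h4 : δ + 1 ≠ 0 := fun e => hδ.2 (by linear_combination e)
  rw [hp.deltaDerivation_eq_zero h h2 h0 h1 h3 h4 hψ.1] at hne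
  exact hne (LinearMap.ext fun _ => rfl)

theorem IsParityPrime.kantorEvenDeltaDerivations_eq (hp : IsParityPrime m σ)
    (h : IsParityLie m σ) (h2 : (2 : F) ≠ 0) (hδ : δ = 1 / 2 ∨ δ = -1) :
    kantorEvenDeltaDerivations m br δ =
      kantorExtend '' (deltaDerivations m δ ∩ deltaDerivations br δ) := by
  have h0 : δ ≠ 0 := by
    rcases hδ with rfl | rfl
    · exact one_div_ne_zero h2
    · exact neg_ne_zero.2 one_ne_zero
  have h1 : δ ≠ 1 := by
    rcases hδ with rfl | rfl <;> intro e
    · rw [div_eq_iff h2] at e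
      exact one_ne_zero (α := F) (by linear_combination -e)
    · exact h2 (by linear_combination -e)
  refine Set.Subset.antisymm (fun φ hφ => hp.exists_eq_kantorExtend h h2 h0 h1 hφ) ?_
  rintro _ ⟨ψ, hψ, rfl⟩
  exact kantorExtend_mem_kantorEvenDeltaDerivations hψ.1 hψ.2

end KantorDouble

theorem mainTheorem7 {F : Type*} [Field F] (h2 : (2 : F) ≠ 0) :
    (∀ (L : Type*) [LieRing L] [LieAlgebra F L], IsPrimeAlgebra (lieMul F L) →
      ∀ br : L →ₗ[F] L →ₗ[F] L,
        (∀ (δ : F) (φ : (L × L) →ₗ[F] (L × L)),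
          IsKantorEven φ →
          IsNontrivialDeltaDerivation (kantorMul (lieMul F L) br) δ φ →
          δ = 1 / 2 ∨ δ = -1) ∧
        (∀ δ : F, δ = 1 / 2 ∨ δ = -1 →
          kantorEvenDeltaDerivations (lieMul F L) br δ =
            kantorExtend '' (deltaDerivations (lieMul F L) δ ∩ deltaDerivations br δ))) ∧
    (∀ (A : Type*) [AddCommGroup A] [Module F A] (m : A →ₗ[F] A →ₗ[F] A)
      (𝒜 : ZMod 2 → Submodule F A), IsLieSuperalgebra m 𝒜 → IsPrimeSuperalgebra m 𝒜 →
      ∀ br : A →ₗ[F] A →ₗ[F] A,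
        (∀ (δ : F) (φ : (A × A) →ₗ[F] (A × A)),
          IsKantorEven φ →
          IsNontrivialDeltaDerivation (kantorMul m br) δ φ →
          δ = 1 / 2 ∨ δ = -1) ∧
        (∀ δ : F, δ = 1 / 2 ∨ δ = -1 →
          kantorEvenDeltaDerivations m br δ =
            kantorExtend '' (deltaDerivations m δ ∩ deltaDerivations br δ))) := by
  refine ⟨fun L _ _ hp br => ?_, fun A _ _ m 𝒜 h hp br => ?_⟩
  · exact ⟨fun δ φ => hp.isParityPrime.eq_of_isNontrivialDeltaDerivation (isParityLie_lieMul h2 L) h2,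
      fun δ => hp.isParityPrime.kantorEvenDeltaDerivations_eq (isParityLie_lieMul h2 L) h2⟩
  · exact ⟨fun δ φ => (hp.isParityPrime h h2).eq_of_isNontrivialDeltaDerivation (h.isParityLie h2) h2,
      fun δ => (hp.isParityPrime h h2).kantorEvenDeltaDerivations_eq (h.isParityLie h2) h2⟩
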